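/- A streaming algorithm with buffer sizes $\beta(t)\in\mathbb{N}$ ($t\ge 0$; $\beta(-1)=1$) consists of maps $u^{(t)}:\mathbb{R}^{\beta(t-1)}\times\mathbb{R}\to\mathbb{R}^{\beta(t)}$ and $m^{(t)}:\mathbb{R}^{\beta(t)}\to\mathbb{R}$. On a real stream $z_0,z_1,\dots$ its states are $s^{(-1)}=0$ and $s^{(t)}=u^{(t)}(s^{(t-1)},z_t)$, its output at time $t$ is $m^{(t)}(s^{(t)})$, and for every $t$ the map $(z_0,\dots,z_t)\mapsto s^{(t)}$ is required to be continuous. For a formal power series $G(x)=\sum_{k\ge 0}a_kx^k$ with real coefficients, let $\mathsf{space}_G(t;\tau)$ be the minimum $b$ such that some streaming algorithm outputs $\sum_{j=0}^{t'}a_{t'-j}z_j$ at time $t'$ for every stream $z$ and every time $t'\le\tau$, and satisfies $\beta(t')\le b$ for all $0\le t'\le t$. Theorem. Let $0\le\mu<\lambda\le 1$, let $G_{\lambda,\mu}(x)=\frac{1}{(1-\lambda x)(1-\mu x)}$, and let $\sqrt{G_{\lambda,\mu}}$ be its formal power series square root with positive constant coefficient. Then for all $t\in\mathbb{N}$, $$\mathsf{space}_{\sqrt{G_{\lambda,\mu}}}(t;2t)\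 \ge\ t-4 .$$ -/

import Mathlib

/-! ### The streaming model -/

/-- The number of real memory cells in use after `n` inputs have been read, where `β t` is the
buffer size at time `t` (that is, after reading `z_0, …, z_t`). Before the first input the buffer
has size `1`, i.e. `β (-1) = 1`. -/
def bufferAfter (β : ℕ → ℕ) : ℕ → ℕ
  | 0 => 1
  | t + 1 => β t

/-- The memory state after reading the `n` inputs `z_0, …, z_{n-1}`: it starts at `0`, and on input
`z_t` it is updated by `u t`. -/
def streamState (β : ℕ → ℕ)
    (u : (t : ℕ) → (Fin (bufferAfter β t) → ℝ) → ℝ → (Fin (β t) → ℝ)) :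
    (n : ℕ) → (Fin n → ℝ) → (Fin (bufferAfter β n) → ℝ)
  | 0, _ => fun _ => 0
  | n + 1, z => u n (streamState β u n (fun i => z i.castSucc)) (z (Fin.last n))

/-- A streaming algorithm over the reals. The update maps `u` and the output maps `m` are arbitrary,
except that each state must be a continuous function of the inputs read so far. -/
structure StreamingAlgorithm where
  /-- buffer size at each time `t ≥ 0` -/
  β : ℕ → ℕ
  /-- update maps -/
  u : (t : ℕ) → (Fin (bufferAfter β t) → ℝ) → ℝ → (Fin (β t) → ℝ)
  /-- output maps -/
  m : (t : ℕ) → (Fin (β t) → ℝ) → ℝ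
  /-- `(z_0, …, z_{n-1}) ↦ state` is continuous -/
  continuous_state : ∀ n, Continuous (streamState β u n)

/-- The output of the algorithm at time `t` on the stream `z`. -/
def StreamingAlgorithm.output (A : StreamingAlgorithm) (z : ℕ → ℝ) (t : ℕ) : ℝ :=
  A.m t (streamState A.β A.u (t + 1) (fun i => z i))

/-- The algorithm computes `M` correctly up to time `τ` (inclusive; `τ = ⊤` means forever): for every
stream `z` and every time `t ≤ τ`, the output at time `t` is `(M z)_t = ∑ j, M t j * z j`. -/
def StreamingAlgorithm.ComputesUpTo (A : StreamingAlgorithm) (M : Matrix ℕ ℕ ℝ) (τ : ℕ∞) : Prop :=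
  ∀ (z : ℕ → ℝ) (t : ℕ), (t : ℕ∞) ≤ τ → HasSum (fun j => M t j * z j) (A.output z t)

/-- `space M t τ`: the minimum `b` such that some streaming algorithm computes `M` correctly up to
time `τ` and has buffer size at most `b` at all times `0, …, t` (`⊤` if there is no such `b`). -/
noncomputable def space (M : Matrix ℕ ℕ ℝ) (t : ℕ) (τ : ℕ∞) : ℕ∞ :=
  ⨅ (b : ℕ) (_ : ∃ A : StreamingAlgorithm, A.ComputesUpTo M τ ∧ ∀ t' ≤ t, A.β t' ≤ b), (b : ℕ∞)

/-- The lower-triangular Toeplitz matrix `T[a]`. -/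
def toeplitz (a : ℕ → ℝ) : Matrix ℕ ℕ ℝ :=
  Matrix.of fun i j => if j ≤ i then a (i - j) else 0

/-- Space complexity of the streaming problem with generating function `G = ∑ a_k x^k`, i.e. of
`T[a]`. -/
noncomputable def spaceGF (G : PowerSeries ℝ) (t : ℕ) (τ : ℕ∞) : ℕ∞ :=
  space (toeplitz fun k => PowerSeries.coeff k G) t τ

/-- Sanity fact: the minimum in `space` is over a non-empty set for Toeplitz matrices, since storing
the whole history is always possible. -/
theorem space_toeplitz_le (a : ℕ → ℝ) (t : ℕ) (τ : ℕ∞) :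
    space (toeplitz a) t τ ≤ (t : ℕ∞) + 1 := by
  let u : (s : ℕ) → (Fin (bufferAfter (fun s => s + 1) s) → ℝ) → ℝ → (Fin (s + 1) → ℝ) :=
    fun s => match s with
      | 0 => fun _ x _ => x
      | _ + 1 => fun v x => Fin.snoc (α := fun _ => ℝ) v x
  have hst : ∀ n (z : Fin (n + 1) → ℝ), streamState (fun s => s + 1) u (n + 1) z = z := by
    intro n
    induction n with
    | zero =>
      intro z
      funext i
      have hi : i = Fin.last 0 := Fin.ext (Nat.lt_one_iff.1 i.2)
      rw [hi]
      rfl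
    | succ n ih =>
      intro z
      change Fin.snoc (α := fun _ => ℝ)
        (streamState (fun s => s + 1) u (n + 1) (fun i => z i.castSucc)) (z (Fin.last _)) = z
      rw [ih]
      exact Fin.snoc_init_self (α := fun _ => ℝ) z
  let A : StreamingAlgorithm :=
    { β := fun s => s + 1
      u := u
      m := fun s v => ∑ j : Fin (s + 1), a (s - j) * v j
      continuous_state := by
        intro n
        cases n with
        | zero => exact continuous_const
        | succ n =>
          have h : streamState (fun s => s + 1) u (n + 1) = id := funext (hst n)
          rw [h]
          exact continuous_id }
  refine (iInf₂_le (t + 1) ⟨A, ?_, fun t' h => Nat.succ_le_succ h⟩).trans (by push_cast; rfl)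
  intro z s _
  have ho : A.output z s = ∑ j ∈ Finset.range (s + 1), toeplitz a s j * z j := by
    change ∑ j : Fin (s + 1), a (s - j) *
      streamState (fun s => s + 1) u (s + 1) (fun i => z i) j = _
    rw [hst, Finset.sum_range]
    refine Finset.sum_congr rfl fun j _ => ?_
    have hj : (j : ℕ) ≤ s := Nat.lt_succ_iff.1 j.2
    simp [toeplitz, hj]
  rw [ho]
  refine hasSum_sum_of_ne_finset_zero fun j hj => ?_
  have hj' : ¬ j ≤ s := by simpa [Nat.lt_succ_iff] using hj
  simp [toeplitz, hj']

/-! ### Square roots of formal power series and the generating function -/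

/-- Coefficients of the formal square root of `F` (for `F` with positive constant coefficient): the
unique solution of `∑_{i+j=n} s_i s_j = F_n` with `s_0 > 0`. -/
noncomputable def sqrtCoeff (F : PowerSeries ℝ) : ℕ → ℝ
  | 0 => √(PowerSeries.coeff 0 F)
  | n + 1 => (PowerSeries.coeff (n + 1) F -
      ∑ i : Fin n, sqrtCoeff F (i + 1) * sqrtCoeff F (n - i)) / (2 * √(PowerSeries.coeff 0 F))
  decreasing_by all_goals omega

/-- The formal square root of `F` with positive constant coefficient (for `F` with positive constant
coefficient). -/
noncomputable def sqrtSeries (F : PowerSeries ℝ) : PowerSeries ℝ :=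
  PowerSeries.mk (sqrtCoeff F)

/-- `sqrtSeries F` is a square root of `F`. -/
theorem sqrtSeries_sq (F : PowerSeries ℝ) (hF : 0 < PowerSeries.constantCoeff F) :
    sqrtSeries F ^ 2 = F := by
  have h0 : 0 < PowerSeries.coeff 0 F := by simpa using hF
  have hs : √(PowerSeries.coeff 0 F) ≠ 0 := (Real.sqrt_pos.2 h0).ne'
  ext n
  rw [sq, PowerSeries.coeff_mul, Finset.Nat.sum_antidiagonal_eq_sum_range_succ_mk]
  simp only [sqrtSeries, PowerSeries.coeff_mk]
  cases n with
  | zero =>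
    simp only [Finset.sum_range_one, Nat.sub_zero]
    rw [sqrtCoeff]
    exact Real.mul_self_sqrt h0.le
  | succ n =>
    rw [Finset.sum_range_succ, Finset.sum_range_succ', Finset.sum_range]
    have e : ∀ i : Fin n, sqrtCoeff F (i + 1) * sqrtCoeff F (n + 1 - (i + 1)) =
        sqrtCoeff F (i + 1) * sqrtCoeff F (n - i) := by
      intro i
      rw [Nat.add_sub_add_right]
    rw [Finset.sum_congr rfl fun i _ => e i]
    have h1 : sqrtCoeff F 0 = √(PowerSeries.coeff 0 F) := by rw [sqrtCoeff]
    have h2 : sqrtCoeff F (n + 1) * (2 * √(PowerSeries.coeff 0 F)) = PowerSeries.coeff (n + 1) F -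
        ∑ i : Fin n, sqrtCoeff F (i + 1) * sqrtCoeff F (n - i) := by
      rw [sqrtCoeff]
      exact div_mul_cancel₀ _ (mul_ne_zero two_ne_zero hs)
    simp only [Nat.sub_zero, Nat.sub_self, h1]
    linarith

/-- The generating function `G_{lam,mu} = 1 / ((1 - lam x) (1 - mu x))`, as a formal power series
(the denominator has constant coefficient `1`). -/
noncomputable def weightedGF (lam mu : ℝ) : PowerSeries ℝ :=
  ((1 - PowerSeries.C lam * PowerSeries.X) * (1 - PowerSeries.C mu * PowerSeries.X))⁻¹

/-! ### Volume of perturbations of the identity -/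

section

/-! Suppose two inputs `z`, `w` of length `t + 1` lead to the same state. Continuing both with zeros
gives equal outputs at times `t, …, 2t`, so with `Q = ∑ (z_j - w_j) x^j` and `y = √G` the
coefficients of `Q y` vanish in that range. Hence `Q y ≡ P` modulo `x^(2t+1)` with `deg P < t`. Put
`D = (1 - λx)(1 - μx)`, so that `y² D = 1`. Then `Q² - P² D` is divisible by `x^(2t+1)` but has
degree at most `2t`, so it is zero; this forces `Q = 0`, since `D` has a simple root at `1/λ`.

So the state at time `t` is a continuous injective function of `t + 1` reals, and invariance of
dimension gives `β(t) ≥ t + 1`. Invariance of dimension is derived from the absence of a smooth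
retraction onto the sphere, which rests on a volume computation: the integral of `det (1 + s g')`
over the ball is polynomial in `s` and constant for small `s`. -/

/-- Lagrange interpolation at `n + 1` nodes near `0`. It carries the volume identity from small
parameters to parameter `1` pointwise under the integral. -/
theorem exists_eval_one_eq_sum (n : ℕ) {ε : ℝ} (hε : 0 < ε) :
    ∃ (s : Finset ℝ) (w : ℝ → ℝ), (∀ t ∈ s, 0 < t ∧ t < ε) ∧
      ∀ p : Polynomial ℝ, p.natDegree ≤ n → p.eval 1 = ∑ t ∈ s, w t * p.eval t := by
  obtain ⟨s, hs, hcard⟩ := (Set.Ioo_infinite hε).exists_subset_card_eq (n + 1)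
  refine ⟨s, fun t => (Lagrange.basis s id t).eval 1, fun t ht => hs ht, fun p hp => ?_⟩
  have hdeg : p.degree < (s.card : WithBot ℕ) := by
    rw [hcard]
    exact Polynomial.degree_lt_iff_coeff_zero _ _ |>.2 fun m hm =>
      Polynomial.coeff_eq_zero_of_natDegree_lt (by omega)
  have h := Lagrange.eq_interpolate (s := s) (v := id) Function.injective_id.injOn hdeg
  conv_lhs => rw [h, Lagrange.interpolate_apply]
  rw [Polynomial.eval_finsetSum]
  refine Finset.sum_congr rfl fun t _ => ?_
  simp [mul_comm]

variable {E : Type*} [NormedAddCommGroup E] [NormedSpace ℝ E]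

/-- A function vanishing off a ball and Lipschitz on its closure, where it vanishes on the sphere,
is Lipschitz. -/
theorem LipschitzOnWith.indicator_closedBall {F : Type*} [NormedAddCommGroup F] {g : E → F}
    {K : NNReal} (hg : LipschitzOnWith K g (Metric.closedBall 0 1))
    (h0 : ∀ x, ‖x‖ = 1 → g x = 0) :
    LipschitzWith K ((Metric.closedBall (0 : E) 1).indicator g) := by
  have key : ∀ x y : E, ‖x‖ ≤ 1 → 1 < ‖y‖ → dist (g x) 0 ≤ K * dist x y := by
    intro x y hx hy
    -- The segment from `x` to `y` crosses the sphere, where `g` vanishes.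
    obtain ⟨s, hs, hs1⟩ : ∃ s ∈ Set.Icc (0 : ℝ) 1, ‖AffineMap.lineMap x y s‖ = 1 := by
      have hc : ContinuousOn (fun s : ℝ => ‖AffineMap.lineMap x y s‖) (Set.Icc 0 1) :=
        (AffineMap.lineMap_continuous.norm).continuousOn
      exact intermediate_value_Icc zero_le_one hc ⟨by simpa using hx, by simpa using hy.le⟩
    rw [← h0 _ hs1]
    refine (hg.dist_le_mul x (by simpa using hx) _ (by simp [hs1])).trans ?_
    rw [dist_left_lineMap, Real.norm_of_nonneg hs.1]
    gcongr
    exact mul_le_of_le_one_left dist_nonneg hs.2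
  refine LipschitzWith.of_dist_le_mul fun x y => ?_
  by_cases hx : x ∈ Metric.closedBall (0 : E) 1 <;> by_cases hy : y ∈ Metric.closedBall (0 : E) 1
  · simpa [hx, hy] using hg.dist_le_mul x hx y hy
  · rw [Set.indicator_of_mem hx, Set.indicator_of_notMem hy]
    exact key x y (by simpa using hx) (by simpa using hy)
  · rw [Set.indicator_of_notMem hx, Set.indicator_of_mem hy, dist_comm, dist_comm x]
    exact key y x (by simpa using hy) (by simpa using hx)
  · simp [hx, hy]; positivity

variable [FiniteDimensional ℝ E]

theorem exists_polynomial_eval_eq_det_one_add_smul (A : E →L[ℝ] E) :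
    ∃ p : Polynomial ℝ, p.natDegree ≤ Module.finrank ℝ E ∧
      ∀ t : ℝ, p.eval t = (1 + t • A).det := by
  classical
  let b := Module.finBasis ℝ E
  let M := LinearMap.toMatrix b b (A : E →ₗ[ℝ] E)
  refine ⟨Matrix.det ((Polynomial.X : Polynomial ℝ) • M.map Polynomial.C +
    (1 : Matrix _ _ ℝ).map Polynomial.C), ?_, fun t => ?_⟩
  · simpa using Polynomial.natDegree_det_X_add_C_le M 1
  · rw [ContinuousLinearMap.det, ← LinearMap.det_toMatrix b, ← Polynomial.coe_evalRingHom,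
      RingHom.map_det]
    congr 1
    ext i j
    simp [M, Matrix.one_apply, LinearMap.toMatrix_apply, Finsupp.single_apply, eq_comm, add_comm]
    split_ifs <;> simp [mul_comm]

/-- By the Neumann series `1 + s • A` is invertible for `s ∈ [0, 1]`, so its determinant keeps the
sign it has at `s = 0`. -/
theorem det_one_add_pos {A : E →L[ℝ] E} (hA : ‖A‖ < 1) : 0 < (1 + A).det := by
  have hne : ∀ s ∈ Set.Icc (0 : ℝ) 1, (1 + s • A).det ≠ 0 := by
    intro s hs
    have hlt : ‖-(s • A)‖ < 1 := by
      rw [norm_neg, norm_smul, Real.norm_of_nonneg hs.1]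
      nlinarith [norm_nonneg A, hs.2]
    have hu := isUnit_one_sub_of_norm_lt_one hlt
    rw [sub_neg_eq_add] at hu
    exact (LinearMap.isUnit_det _ (hu.map (ContinuousLinearMap.toLinearMapRingHom (R₁ := ℝ) (M₁ := E)))).ne_zero
  have hc : ContinuousOn (fun s : ℝ => (1 + s • A).det) (Set.Icc 0 1) :=
    (ContinuousLinearMap.continuous_det.comp (by fun_prop)).continuousOn
  by_contra hneg
  push Not at hneg
  obtain ⟨s, hs, h0⟩ := intermediate_value_Icc' zero_le_one hc
    (show (0 : ℝ) ∈ _ from ⟨by simpa using hneg, by simp [ContinuousLinearMap.det]⟩)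
  exact hne s hs h0

variable [MeasurableSpace E] [BorelSpace E]

/-- A small perturbation of the identity supported in a ball maps the ball onto itself, so the
integral of its Jacobian is the volume of the ball. -/
theorem setIntegral_det_one_add_eq_measureReal (μ : MeasureTheory.Measure E)
    [μ.IsAddHaarMeasure] {h : E → E} {h' : E → E →L[ℝ] E}
    {K : NNReal} (hK : K < 1) (hh : LipschitzWith K h) (h0 : ∀ x, 1 ≤ ‖x‖ → h x = 0)
    (hd : ∀ x, ‖x‖ < 1 → HasFDerivAt h (h' x) x) :
    ∫ x in Metric.ball 0 1, (1 + h' x).det ∂μ = μ.real (Metric.ball 0 1) := by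
  set Φ : E → E := fun x => x + h x with hΦ
  -- Identity plus a contraction is bijective; as `Φ` fixes every point outside the ball, it
  -- permutes the ball.
  have happ : ApproximatesLinearOn Φ
      ((ContinuousLinearEquiv.refl ℝ E : E ≃L[ℝ] E) : E →L[ℝ] E) Set.univ K := by
    rw [ApproximatesLinearOn.approximatesLinearOn_iff_lipschitzOnWith, lipschitzOnWith_univ]
    convert hh using 1
    ext x
    simp [hΦ]
  have hc : Subsingleton E ∨
      K < ‖((ContinuousLinearEquiv.refl ℝ E).symm : E →L[ℝ] E)‖₊⁻¹ := by
    rcases subsingleton_or_nontrivial E with hE | hE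
    · exact Or.inl hE
    · right
      simpa using hK
  have hinj : Function.Injective Φ := Set.injOn_univ.1 (happ.injOn hc)
  have hsurj := happ.surjective hc
  have hfix : ∀ x, 1 ≤ ‖x‖ → Φ x = x := fun x hx => by simp [hΦ, h0 x hx]
  have himg : Φ '' Metric.ball 0 1 = Metric.ball 0 1 := by
    ext y
    simp only [Set.mem_image, mem_ball_zero_iff]
    constructor
    · rintro ⟨x, hx, rfl⟩
      by_contra! hy
      have := hinj (hfix _ hy)
      rw [this] at hy
      exact absurd hx (not_lt.2 hy)
    · intro hy
      obtain ⟨x, rfl⟩ := hsurj y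
      refine ⟨x, ?_, rfl⟩
      by_contra! hx
      rw [hfix x hx] at hy
      exact absurd hy (not_lt.2 hx)
  have hder : ∀ x ∈ Metric.ball (0 : E) 1,
      HasFDerivWithinAt Φ (1 + h' x) (Metric.ball 0 1) x := fun x hx =>
    ((hasFDerivAt_id x).add (hd x (by simpa using hx))).hasFDerivWithinAt
  have hpos : ∀ x ∈ Metric.ball (0 : E) 1, 0 < (1 + h' x).det := fun x hx => by
    refine det_one_add_pos (lt_of_le_of_lt ?_ (NNReal.coe_lt_one.2 hK))
    rw [← (hd x (by simpa using hx)).fderiv]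
    exact norm_fderiv_le_of_lipschitz ℝ hh
  have hmain := MeasureTheory.integral_image_eq_integral_abs_det_fderiv_smul μ
    measurableSet_ball hder hinj.injOn (fun _ => (1 : ℝ))
  rw [himg] at hmain
  simp only [smul_eq_mul, mul_one, MeasureTheory.integral_const, MeasureTheory.measureReal_restrict_apply_univ] at hmain
  rw [hmain]
  exact MeasureTheory.setIntegral_congr_fun measurableSet_ball fun x hx =>
    (abs_of_pos (hpos x hx)).symm

/-- A smooth map of a vector space that fixes the unit sphere has a non-degenerate point in the
unit ball. -/
theorem exists_det_fderiv_ne_zero_of_eq_on_sphere {R : E → E} (hR : ContDiff ℝ 1 R)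
    (hfix : ∀ x, ‖x‖ = 1 → R x = x) : ∃ x, ‖x‖ < 1 ∧ (fderiv ℝ R x).det ≠ 0 := by
  by_contra! hdet
  let μ : MeasureTheory.Measure E := MeasureTheory.Measure.addHaar
  set g : E → E := fun x => R x - x with hg
  have hgc : ContDiff ℝ 1 g := hR.sub contDiff_id
  have hcg : Continuous (fderiv ℝ g) := hgc.continuous_fderiv one_ne_zero
  obtain ⟨C, hC⟩ := (isCompact_closedBall (0 : E) 1).exists_bound_of_continuousOn hcg.continuousOn
  have hlip : LipschitzOnWith C.toNNReal g (Metric.closedBall 0 1) :=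
    (convex_closedBall 0 1).lipschitzOnWith_of_nnnorm_fderiv_le
      (fun x _ => hgc.differentiable one_ne_zero x) fun x hx =>
      NNReal.coe_le_coe.1 ((hC x hx).trans (Real.le_coe_toNNReal C))
  have hlip' := hlip.indicator_closedBall fun x hx => by simp [hg, hfix x hx]
  set h := (Metric.closedBall (0 : E) 1).indicator g
  have hh0 : ∀ x, 1 ≤ ‖x‖ → h x = 0 := fun x hx => by
    rcases hx.eq_or_lt with hx | hx
    · simp [h, ← hx, hg, hfix x hx.symm]
    · exact Set.indicator_of_notMem (by simpa using hx) _
  have hhd : ∀ x, ‖x‖ < 1 → HasFDerivAt h (fderiv ℝ g x) x := fun x hx => by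
    refine (hgc.differentiable one_ne_zero x).hasFDerivAt.congr_of_eventuallyEq ?_
    filter_upwards [Metric.isOpen_ball.mem_nhds (show x ∈ Metric.ball (0 : E) 1 by simpa)] with y hy
    exact Set.indicator_of_mem (Metric.ball_subset_closedBall hy) _
  -- Nodes below `1 / (C + 1)` make `t • h` a contraction. At parameter `1` the integrand is `det
  -- R'`, assumed to vanish.
  obtain ⟨s, w, hs, hw⟩ := exists_eval_one_eq_sum (Module.finrank ℝ E)
    (ε := 1 / (C.toNNReal + 1)) (by positivity)
  have hvol : ∀ t ∈ s, ∫ x in Metric.ball 0 1, (1 + t • fderiv ℝ g x).det ∂μ =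
      μ.real (Metric.ball 0 1) := by
    intro t ht
    obtain ⟨ht0, ht1⟩ := hs t ht
    refine setIntegral_det_one_add_eq_measureReal μ (h := fun x => t • h x)
      (K := ‖t‖₊ * C.toNNReal) ?_ ?_ (fun x hx => by simp [hh0 x hx])
      fun x hx => (hhd x hx).const_smul t
    · rw [lt_div_iff₀ (by positivity)] at ht1
      rw [← NNReal.coe_lt_coe]
      push_cast
      rw [Real.norm_of_nonneg ht0.le]
      nlinarith
    · exact (lipschitzWith_smul t).comp hlip'
  have hint : ∀ t : ℝ, MeasureTheory.IntegrableOn (fun x => (1 + t • fderiv ℝ g x).det)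
      (Metric.ball 0 1) μ := fun t =>
    (((ContinuousLinearMap.continuous_det.comp (by fun_prop)).continuousOn.integrableOn_compact
      (isCompact_closedBall (0 : E) 1)).mono_set Metric.ball_subset_closedBall)
  have hpt : ∀ x : E, (1 + (1 : ℝ) • fderiv ℝ g x).det =
      ∑ t ∈ s, w t * (1 + t • fderiv ℝ g x).det := fun x => by
    obtain ⟨p, hp, hpe⟩ := exists_polynomial_eval_eq_det_one_add_smul (fderiv ℝ g x)
    simpa only [hpe] using hw p hp
  have hone : (1 : ℝ) = ∑ t ∈ s, w t := by
    simpa using hw 1 (by simp)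
  have hzero : ∫ x in Metric.ball 0 1, (1 + (1 : ℝ) • fderiv ℝ g x).det ∂μ = 0 := by
    refine MeasureTheory.setIntegral_eq_zero_of_forall_eq_zero fun x hx => ?_
    have : 1 + (1 : ℝ) • fderiv ℝ g x = fderiv ℝ R x := by
      have := ((hR.differentiable one_ne_zero x).hasFDerivAt.sub (hasFDerivAt_id x)).fderiv
      rw [show fderiv ℝ g x = _ from this, one_smul]
      exact add_sub_cancel _ _
    rw [this]
    exact hdet x (by simpa using hx)
  have hone' : ∫ x in Metric.ball 0 1, (1 + (1 : ℝ) • fderiv ℝ g x).det ∂μ =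
      μ.real (Metric.ball 0 1) := by
    simp_rw [hpt]
    rw [MeasureTheory.integral_finsetSum _ fun t _ => (hint t).const_mul _]
    simp_rw [MeasureTheory.integral_const_mul]
    rw [Finset.sum_congr rfl fun t ht => by rw [hvol t ht], ← Finset.sum_mul, ← hone, one_mul]
  have : 0 < μ.real (Metric.ball 0 1) :=
    ENNReal.toReal_pos (Metric.measure_ball_pos μ _ one_pos).ne' MeasureTheory.measure_ball_lt_top.ne
  linarith

end

/-! ### Invariance of dimension -/

section

variable {E : Type*} [NormedAddCommGroup E] [InnerProductSpace ℝ E] [FiniteDimensional ℝ E]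

/-- There is no smooth retraction onto the unit sphere. -/
theorem not_forall_norm_eq_one_of_eq_on_sphere {R : E → E} (hR : ContDiff ℝ 1 R)
    (hfix : ∀ x, ‖x‖ = 1 → R x = x) : ¬ ∀ x, ‖R x‖ = 1 := by
  intro hnorm
  borelize E
  obtain ⟨x, -, hx⟩ := exists_det_fderiv_ne_zero_of_eq_on_sphere hR hfix
  have hd := (hR.differentiable one_ne_zero x).hasFDerivAt
  -- Differentiate `‖R‖² = 1`; an invertible derivative would have `R x` itself in its range.
  have horth : ∀ v, inner ℝ (R x) (fderiv ℝ R x v) = 0 := by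
    intro v
    have h1 := (hd.norm_sq).fderiv
    have h2 : (fun y => ‖R y‖ ^ 2) = fun _ => (1 : ℝ) := by
      ext y
      simp [hnorm]
    rw [h2, fderiv_fun_const] at h1
    have := congrArg (fun L => L v) h1
    simpa using this.symm
  obtain ⟨v, hv⟩ := (LinearMap.equivOfDetNeZero _ hx).surjective (R x)
  have hv' : fderiv ℝ R x v = R x := hv
  have := horth v
  rw [hv', real_inner_self_eq_norm_sq, hnorm] at this
  norm_num at this

/-- A smooth map that is close to the identity has a zero. -/
theorem exists_eq_zero_of_contDiff {Q : E → E} (hQ : ContDiff ℝ 1 Q)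
    (hclose : ∀ x, ‖x‖ ≤ 1 → ‖Q x - x‖ < 1 / 2) : ∃ x, Q x = 0 := by
  by_contra! hne
  -- `F` interpolates between `Q` on the half ball and the identity outside the unit ball. A zero in
  -- between would have norm at most `‖Q x - x‖ < 1 / 2`.
  let φ : ContDiffBump (0 : E) := ⟨1 / 2, 1, by norm_num, by norm_num⟩
  set F : E → E := fun x => x + φ x • (Q x - x) with hF
  have hFc : ContDiff ℝ 1 F := contDiff_id.add (φ.contDiff.smul (hQ.sub contDiff_id))
  have hout : ∀ x, 1 ≤ ‖x‖ → F x = x := fun x hx => by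
    simp [hF, φ.zero_of_le_dist (x := x) (by simpa using hx)]
  have hF0 : ∀ x, F x ≠ 0 := by
    intro x hx
    rcases le_or_gt ‖x‖ (1 / 2) with h1 | h1
    · have : φ x = 1 := φ.one_of_mem_closedBall (mem_closedBall_zero_iff.2 h1)
      rw [hF] at hx
      simp only [this, one_smul, add_sub_cancel] at hx
      exact hne x hx
    · rcases le_or_gt 1 ‖x‖ with h2 | h2
      · rw [hout x h2] at hx
        rw [hx, norm_zero] at h2
        linarith
      · have h3 : x = -(φ x • (Q x - x)) := eq_neg_of_add_eq_zero_left hx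
        have h4 : ‖x‖ ≤ ‖Q x - x‖ := by
          conv_lhs => rw [h3]
          rw [norm_neg, norm_smul, Real.norm_of_nonneg φ.nonneg]
          exact mul_le_of_le_one_left (norm_nonneg _) φ.le_one
        linarith [hclose x h2.le]
  refine not_forall_norm_eq_one_of_eq_on_sphere (R := fun x => ‖F x‖⁻¹ • F x) ?_ ?_ ?_
  · exact ((hFc.norm ℝ hF0).inv fun x => norm_ne_zero_iff.2 (hF0 x)).smul hFc
  · intro x hx
    simp [hout x hx.ge, hx]
  · intro x
    rw [norm_smul, norm_inv, norm_norm, inv_mul_cancel₀ (norm_ne_zero_iff.2 (hF0 x))]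

/-- **Invariance of dimension**: a continuous injection cannot lower the dimension. -/
theorem Continuous.finrank_le_finrank_of_injective {F : Type*} [NormedAddCommGroup F]
    [NormedSpace ℝ F] [FiniteDimensional ℝ F] {f : E → F} (hf : Continuous f)
    (hinj : Function.Injective f) : Module.finrank ℝ E ≤ Module.finrank ℝ F := by
  by_contra! hlt
  let B := Metric.closedBall (0 : E) 1
  have : CompactSpace B := isCompact_iff_compactSpace.1 (isCompact_closedBall 0 1)
  have hemb : Topology.IsClosedEmbedding (fun x : B => f x) :=
    (hf.comp continuous_subtype_val).isClosedEmbedding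
      (hinj.comp Subtype.val_injective)
  -- Tietze extends the inverse of `f` on the image of the ball to all of `F`.
  obtain ⟨g, hg⟩ := ContinuousMap.exists_extension' hemb
    (⟨Subtype.val, continuous_subtype_val⟩ : C(B, E))
  have hgf : ∀ x, ‖x‖ ≤ 1 → g (f x) = x := fun x hx =>
    congrFun hg ⟨x, by simpa [B] using hx⟩
  obtain ⟨G, hGc, hG, -⟩ := g.continuous.exists_contDiff_approx 1
    (continuous_const (y := (1 / 8 : ℝ))) fun _ => by norm_num
  obtain ⟨p, hpc, hp⟩ : ∃ p : E → F, ContDiff ℝ 1 p ∧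
      ∀ x, ‖x‖ ≤ 1 → dist (G (p x)) (G (f x)) < 1 / 8 := by
    -- A compact set containing both `f x` and the nearby `p x`, so that `G` is uniformly continuous
    -- there.
    have hK : IsCompact (Metric.cthickening 1 (f '' Metric.closedBall 0 1)) :=
      ((isCompact_closedBall (0 : E) 1).image hf).cthickening
    obtain ⟨δ, hδ, hδ'⟩ := Metric.uniformContinuousOn_iff.1
      (hK.uniformContinuousOn_of_continuous hGc.continuous.continuousOn) (1 / 8) (by norm_num)
    obtain ⟨p, hpc, hp, -⟩ := hf.exists_contDiff_approx 1
      (continuous_const (y := min δ 1)) fun _ => lt_min hδ one_pos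
    refine ⟨p, hpc, fun x hx => ?_⟩
    have hfx : f x ∈ f '' Metric.closedBall 0 1 := Set.mem_image_of_mem f (by simpa using hx)
    exact hδ' _ (Metric.mem_cthickening_of_dist_le _ _ _ _ hfx ((hp x).le.trans (min_le_right _ _)))
      _ (Metric.self_subset_cthickening _ hfx) ((hp x).trans_le (min_le_left _ _))
  -- A `C¹` map from lower dimension misses points arbitrarily close to `0`. The three errors of `1
  -- / 8` total less than `1 / 2`.
  obtain ⟨y, hy, hy'⟩ := (hGc.dense_compl_range_of_finrank_lt_finrank hlt).exists_dist_lt 0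
    (show (0 : ℝ) < 1 / 8 by norm_num)
  obtain ⟨x, hx⟩ := exists_eq_zero_of_contDiff (Q := fun x => G (p x) - y)
    ((hGc.comp hpc).sub contDiff_const) (by
      intro x hx
      have h1 := hp x hx
      have h2 := hG (f x)
      rw [hgf x hx] at h2
      rw [dist_eq_norm] at h1 h2
      rw [dist_zero_left] at hy'
      calc ‖G (p x) - y - x‖ = ‖(G (p x) - G (f x)) + (G (f x) - x) - y‖ := by congr 1; abel
        _ ≤ ‖G (p x) - G (f x)‖ + ‖G (f x) - x‖ + ‖y‖ :=
          (norm_sub_le _ _).trans (by gcongr; exact norm_add_le _ _)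
        _ < 1 / 2 := by linarith)
  exact hy ⟨p x, sub_eq_zero.1 hx⟩

end

/-! ### The square root is badly approximated by rational functions -/

section

open Polynomial

/-- Compare orders at `lam⁻¹`: even on the left, odd on the right, because `mu ≠ lam` makes it a
simple root of the linear factors. -/
theorem sq_ne_sq_mul_linear_mul_linear {lam mu : ℝ} (hmu : 0 ≤ mu) (hlt : mu < lam) {P Q : ℝ[X]}
    (hQ : Q ≠ 0) : Q ^ 2 ≠ P ^ 2 * ((1 - C lam * X) * (1 - C mu * X)) := by
  intro h
  have hl : 0 < lam := hmu.trans_lt hlt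
  have hP : P ^ 2 ≠ 0 := by
    intro h0
    rw [h0, zero_mul] at h
    exact hQ (pow_eq_zero_iff two_ne_zero |>.1 h)
  have hD : (1 - C lam * X) * (1 - C mu * X) =
      (X - C lam⁻¹) * (C (-lam) * (1 - C mu * X)) := by
    have : (1 : ℝ[X]) = C lam * C lam⁻¹ := by rw [← C_mul, mul_inv_cancel₀ hl.ne', C_1]
    rw [C_neg]
    linear_combination (1 - C mu * X) * this
  have hroot : ¬ IsRoot (C (-lam) * (1 - C mu * X)) lam⁻¹ := by
    simp only [IsRoot, eval_mul, eval_C, eval_sub, eval_one, eval_X, mul_eq_zero, neg_eq_zero,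
      hl.ne', false_or, sub_eq_zero]
    intro h1
    rw [eq_mul_inv_iff_mul_eq₀ hl.ne', one_mul] at h1
    exact hlt.ne' h1
  have hne : C (-lam) * (1 - C mu * X) ≠ 0 := fun h0 => hroot (by rw [h0]; exact eval_zero)
  have hm := congrArg (rootMultiplicity lam⁻¹) h
  rw [hD, rootMultiplicity_mul (mul_ne_zero hP (mul_ne_zero (X_sub_C_ne_zero _) hne)),
    rootMultiplicity_mul (mul_ne_zero (X_sub_C_ne_zero _) hne),
    rootMultiplicity_X_sub_C_self, rootMultiplicity_eq_zero hroot, sq, sq,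
    rootMultiplicity_mul (mul_ne_zero hQ hQ), rootMultiplicity_mul (by rwa [← sq])] at hm
  omega

/-- A non-zero polynomial of degree at most `t` times the square root of `weightedGF` has a non-zero
coefficient of order in `[t, 2t]`. -/
theorem eq_zero_of_coeff_mul_sqrtSeries_eq_zero {lam mu : ℝ} (hmu : 0 ≤ mu) (hlt : mu < lam)
    {t : ℕ} {Q : ℝ[X]} (hQ : Q.natDegree ≤ t)
    (h : ∀ n, t ≤ n → n ≤ 2 * t →
      PowerSeries.coeff n ((Q : PowerSeries ℝ) * sqrtSeries (weightedGF lam mu)) = 0) : Q = 0 := by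
  by_contra hQ0
  set y := sqrtSeries (weightedGF lam mu)
  let D : ℝ[X] := (1 - C lam * X) * (1 - C mu * X)
  have hDcoe : (D : PowerSeries ℝ) =
      (1 - PowerSeries.C lam * PowerSeries.X) * (1 - PowerSeries.C mu * PowerSeries.X) := by
    simp [D]
  have hD0 : PowerSeries.constantCoeff (D : PowerSeries ℝ) ≠ 0 := by
    simp [hDcoe]
  have hG : weightedGF lam mu = (D : PowerSeries ℝ)⁻¹ := by rw [hDcoe]; rfl
  have hy : y ^ 2 * D = 1 := by
    rw [sqrtSeries_sq _ (by simp [weightedGF]), hG, PowerSeries.inv_mul_cancel _ hD0]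
  -- Truncation gives `deg P ≤ t - 1` (and `P = 0` if `t = 0`), which leaves room for `deg D = 2` in
  -- `deg (P² D) ≤ 2t`.
  let P : ℝ[X] := PowerSeries.trunc t ((Q : PowerSeries ℝ) * y)
  have hdvd : (PowerSeries.X : PowerSeries ℝ) ^ (2 * t + 1) ∣ (Q : PowerSeries ℝ) * y - P := by
    rw [PowerSeries.X_pow_dvd_iff]
    intro n hn
    rw [map_sub, coeff_coe, PowerSeries.coeff_trunc]
    split_ifs with hnt
    · exact sub_self _
    · rw [h n (by omega) (by omega), sub_zero]
  have hdvd2 : (PowerSeries.X : PowerSeries ℝ) ^ (2 * t + 1) ∣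
      ((Q ^ 2 - P ^ 2 * D : ℝ[X]) : PowerSeries ℝ) := by
    have : ((Q ^ 2 - P ^ 2 * D : ℝ[X]) : PowerSeries ℝ) =
        ((Q : PowerSeries ℝ) * y - P) * (((Q : PowerSeries ℝ) * y + P) * D) := by
      push_cast
      linear_combination -(Q : PowerSeries ℝ) ^ 2 * hy
    rw [this]
    exact hdvd.mul_right _
  have hDdeg : D.natDegree ≤ 2 := by
    simp only [D]
    compute_degree
  have hPdeg : (P ^ 2 * D).natDegree ≤ 2 * t := by
    rcases Nat.eq_zero_or_pos t with rfl | ht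
    · simp [P]
    · obtain ⟨s, rfl⟩ : ∃ s, t = s + 1 := ⟨t - 1, by omega⟩
      have h1 : P.natDegree < s + 1 := PowerSeries.natDegree_trunc_lt _ _
      have h2 := natDegree_pow_le (p := P) (n := 2)
      have h3 := natDegree_mul_le (p := P ^ 2) (q := D)
      omega
  have hdeg : (Q ^ 2 - P ^ 2 * D).natDegree ≤ 2 * t := by
    have h2 := natDegree_pow_le (p := Q) (n := 2)
    exact (natDegree_sub_le _ _).trans (max_le (by omega) hPdeg)
  have hzero : Q ^ 2 - P ^ 2 * D = 0 := by
    ext n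
    rcases le_or_gt n (2 * t) with hn | hn
    · rw [← coeff_coe, PowerSeries.X_pow_dvd_iff.1 hdvd2 n (by omega), coeff_zero]
    · rw [coeff_eq_zero_of_natDegree_lt (by omega), coeff_zero]
  exact sq_ne_sq_mul_linear_mul_linear hmu hlt hQ0 (sub_eq_zero.1 hzero)

end

/-! ### States of streaming algorithms -/

section

/-- The stream `z_0, …, z_{n-1}, 0, 0, …`. -/
def extendByZero {n : ℕ} (z : Fin n → ℝ) (i : ℕ) : ℝ :=
  if h : i < n then z ⟨i, h⟩ else 0

theorem streamState_extendByZero_congr (A : StreamingAlgorithm) {n : ℕ} {z w : Fin n → ℝ}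
    (h : streamState A.β A.u n z = streamState A.β A.u n w) (k : ℕ) :
    streamState A.β A.u (n + k) (fun i => extendByZero z i) =
      streamState A.β A.u (n + k) (fun i => extendByZero w i) := by
  induction k with
  | zero => simpa [extendByZero] using h
  | succ k ih =>
    change A.u (n + k) (streamState A.β A.u (n + k) fun i => extendByZero z i) _ =
      A.u (n + k) (streamState A.β A.u (n + k) fun i => extendByZero w i) _
    rw [ih]
    simp [extendByZero]

theorem sum_toeplitz_eq_of_streamState_eq {A : StreamingAlgorithm} {a : ℕ → ℝ} {τ : ℕ∞}
    (hA : A.ComputesUpTo (toeplitz a) τ) {t : ℕ} {z w : Fin (t + 1) → ℝ}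
    (h : streamState A.β A.u (t + 1) z = streamState A.β A.u (t + 1) w) {n : ℕ} (htn : t ≤ n)
    (hn : (n : ℕ∞) ≤ τ) : ∑ j : Fin (t + 1), a (n - j) * z j = ∑ j : Fin (t + 1), a (n - j) * w j := by
  have key : ∀ v : Fin (t + 1) → ℝ,
      A.output (extendByZero v) n = ∑ j : Fin (t + 1), a (n - j) * v j := by
    intro v
    refine (hA (extendByZero v) n hn).unique ?_
    have : ∑ j : Fin (t + 1), a (n - j) * v j =
        ∑ j ∈ Finset.range (t + 1), toeplitz a n j * extendByZero v j := by
      rw [Finset.sum_range]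
      refine Finset.sum_congr rfl fun j _ => ?_
      have hj : (j : ℕ) ≤ n := by omega
      simp [toeplitz, extendByZero, hj, show ¬ t < (j : ℕ) by omega]
    rw [this]
    refine hasSum_sum_of_ne_finset_zero fun j hj => ?_
    have : ¬ j < t + 1 := by simpa using hj
    simp [extendByZero, this]
  rw [← key, ← key]
  obtain ⟨k, rfl⟩ := Nat.exists_eq_add_of_le htn
  have := streamState_extendByZero_congr A h k
  rw [show t + 1 + k = t + k + 1 by omega] at this
  exact congrArg (A.m (t + k)) this

/-- An algorithm for the square root of `weightedGF` remembers its whole input. -/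
theorem streamState_injective {lam mu : ℝ} (hmu : 0 ≤ mu) (hlt : mu < lam) {t : ℕ}
    {A : StreamingAlgorithm}
    (hA : A.ComputesUpTo (toeplitz fun k => PowerSeries.coeff k (sqrtSeries (weightedGF lam mu)))
      ((2 * t : ℕ) : ℕ∞)) : Function.Injective (streamState A.β A.u (t + 1)) := by
  intro z w h
  let Q : Polynomial ℝ := ∑ j : Fin (t + 1), Polynomial.monomial j (z j - w j)
  have hQc : ∀ j : Fin (t + 1), Q.coeff j = z j - w j := by
    intro j
    simp [Q, Polynomial.coeff_monomial, Fin.val_inj]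
  have hQd : Q.natDegree ≤ t :=
    Polynomial.natDegree_sum_le_of_forall_le _ _ fun j _ =>
      (Polynomial.natDegree_monomial_le _).trans (by omega)
  have hQ : Q = 0 := by
    refine eq_zero_of_coeff_mul_sqrtSeries_eq_zero hmu hlt hQd fun n htn hn => ?_
    have hsum := sum_toeplitz_eq_of_streamState_eq hA h htn (by exact_mod_cast hn)
    rw [← sub_eq_zero, ← Finset.sum_sub_distrib] at hsum
    rw [← hsum, PowerSeries.coeff_mul, Finset.Nat.sum_antidiagonal_eq_sum_range_succ
      (fun i j => PowerSeries.coeff i (Q : PowerSeries ℝ) * PowerSeries.coeff j _),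
      ← Finset.sum_subset (Finset.range_subset_range.2 (show t + 1 ≤ n + 1 by omega)), Finset.sum_range]
    · refine Finset.sum_congr rfl fun j _ => ?_
      rw [Polynomial.coeff_coe, hQc]
      ring
    · intro j _ hj
      rw [Polynomial.coeff_coe, Polynomial.coeff_eq_zero_of_natDegree_lt, zero_mul]
      simp at hj
      omega
  funext j
  have := hQc j
  rw [hQ, Polynomial.coeff_zero] at this
  linarith

end

/-- The exact lower bound: the whole input has to be stored. -/
theorem add_one_le_spaceGF_sqrtSeries {lam mu : ℝ} (hmu : 0 ≤ mu) (hlt : mu < lam) (t : ℕ) :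
    (t : ℕ∞) + 1 ≤ spaceGF (sqrtSeries (weightedGF lam mu)) t ((2 * t : ℕ) : ℕ∞) := by
  refine le_iInf₂ fun b ⟨A, hA, hb⟩ => ?_
  have hinj := streamState_injective hmu hlt hA
  -- The domain is given its Euclidean norm because invariance of dimension is proved for inner
  -- product spaces.
  have hdim := ((A.continuous_state (t + 1)).comp
    (PiLp.continuous_ofLp 2 (fun _ : Fin (t + 1) => ℝ))).finrank_le_finrank_of_injective
    (E := EuclideanSpace ℝ (Fin (t + 1))) (hinj.comp (WithLp.ofLp_injective 2))
  rw [finrank_euclideanSpace_fin] at hdim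
  have : Module.finrank ℝ (Fin (bufferAfter A.β (t + 1)) → ℝ) = A.β t := by
    rw [Module.finrank_fin_fun]
    rfl
  rw [this] at hdim
  exact_mod_cast hdim.trans (hb t le_rfl)

theorem theorem4 (lam mu : ℝ) (hmu : 0 ≤ mu) (hlt : mu < lam) (hlam : lam ≤ 1) (t : ℕ) :
    (t : ℕ∞) ≤ spaceGF (sqrtSeries (weightedGF lam mu)) t ((2 * t : ℕ) : ℕ∞) + 4 :=
  le_self_add.trans ((add_one_le_spaceGF_sqrtSeries hmu hlt t).trans le_self_add)
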